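/- Let $G$ be a finite group and let $\pi$ be a set of primes, with complement $\pi'$ in the set of all primes. Let $N\le M$ be normal subgroups of $G$ such that every prime divisor of $|M/N|$ lies in $\pi$ (that is, $M/N$ is a $\pi$-factor of $G$). Let $Z^2G$ be the group of 2-cocycles of $G$ with values in $\mathbb C^\times$ (with trivial action), and let $H^2G=Z^2G/B^2G$ be the Schur multiplier. For $c=[\alpha]\in H^2G$ with $\alpha\in Z^2G$, a $c$-module of $G$ (with respect to the representative $\alpha$) is a finite-dimensional complex vector space $V$ with a map $\varphi:G\to \mathrm{GL}(V)$ such that $\varphi(x)\varphi(y)=\alpha(x,y)\varphi(xy)$ for all $x,y\in G$. Its degree is $\dim V$, and it is irreducible if $V\neq 0$ and its only $\varphi(G)$-invariant subspaces are $0$ and $V$. A $c|_N$-module of $N$ is defined in the same way with respect to the representative $\alpha|_{N\times N}$ of $c|_N$. A $c$-module $X$ of $G$ lies over an irreducible $c|_N$-module $V$ if the restriction of $X$ to $N$ has a submodule isomorphic to $V$. Suppose that there are a coclass $c\in H^2G$, with a representative $\alpha$, and an irreducible $c|_N$-module $V$ of $N$ such that no prime in $\pi$ divides the degree of any irreducible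 $c$-module $X$ of $G$ lying over $V$. Then $M/N$ is abelian. -/

import Mathlib

namespace ProjectiveRep

/-- The group `Z²G` of 2-cocycles of `G` with values in `ℂˣ` (trivial action), under
pointwise multiplication. -/
def Z2 (G : Type*) [Group G] : Subgroup (G → G → ℂˣ) where
  carrier := {α | ∀ x y z : G, α x y * α (x * y) z = α y z * α x (y * z)}
  one_mem' := by intro x y z; simp
  mul_mem' := by
    intro α β hα hβ x y z
    have h1 := hα x y z
    have h2 := hβ x y z
    simp only [Pi.mul_apply]
    rw [mul_mul_mul_comm, h1, h2, mul_mul_mul_comm]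
  inv_mem' := by
    intro α hα x y z
    have h1 := hα x y z
    simp only [Pi.inv_apply]
    rw [← mul_inv, h1, mul_inv]

/-- The coboundary homomorphism `ζ ↦ δζ`, where `δζ(x, y) = ζ(x) ζ(y) ζ(xy)⁻¹`. -/
def delta (G : Type*) [Group G] : (G → ℂˣ) →* Z2 G where
  toFun ζ := ⟨fun x y => ζ x * ζ y * (ζ (x * y))⁻¹, by
    intro x y z
    apply Units.ext
    simp only [mul_assoc x y z]
    push_cast
    field_simp⟩
  map_one' := by ext; simp
  map_mul' ζ ξ := by
    apply Subtype.ext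
    funext x y
    simp only [Pi.mul_apply, Subgroup.coe_mul, mul_inv]
    apply Units.ext
    push_cast
    ring

/-- The group `B²G` of 2-coboundaries. -/
def B2 (G : Type*) [Group G] : Subgroup (Z2 G) := (delta G).range

/-- The Schur multiplier `H²G = Z²G / B²G`. -/
abbrev SchurMultiplier (G : Type*) [Group G] : Type _ := Z2 G ⧸ B2 G

/-- The coclass of a cocycle. -/
def coclass {G : Type*} [Group G] : Z2 G →* SchurMultiplier G := QuotientGroup.mk' (B2 G)

/-- Restriction of a cocycle to a subgroup. -/
def resZ2 {G : Type*} [Group G] (N : Subgroup G) : Z2 G →* Z2 N where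
  toFun α := ⟨fun x y => (α : G → G → ℂˣ) x y, fun x y z => α.2 x y z⟩
  map_one' := rfl
  map_mul' _ _ := rfl

/-- Projective representations of `G` on `V` with cocycle `α`, that is, maps `φ : G → GL(V)` with
`φ(x) φ(y) = α(x, y) φ(xy)`.  For `[α] = c` these are the `c`-modules of `G` (the modules over the
twisted group algebra `ℂᶜG`), written with respect to the representative `α` of `c`. -/
structure CocycleRep {G : Type*} [Group G] (α : Z2 G)
    (V : Type*) [AddCommGroup V] [Module ℂ V] where
  toFun : G → (V ≃ₗ[ℂ] V)
  map_mul : ∀ (x y : G) (v : V),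
    toFun x (toFun y v) = (((α : G → G → ℂˣ) x y : ℂˣ) : ℂ) • toFun (x * y) v

namespace CocycleRep

variable {G : Type*} [Group G] {α : Z2 G} {V : Type*} [AddCommGroup V] [Module ℂ V]

/-- `V` is nonzero and its only submodules are `0` and `V`. -/
def IsIrreducible (φ : CocycleRep α V) : Prop :=
  Nontrivial V ∧ ∀ U : Submodule ℂ V, (∀ (g : G), ∀ v ∈ U, φ.toFun g v ∈ U) → U = ⊥ ∨ U = ⊤

/-- The restriction of a projective representation to a subgroup. -/
def res (φ : CocycleRep α V) (N : Subgroup G) : CocycleRep (resZ2 N α) V where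
  toFun x := φ.toFun x
  map_mul x y v := φ.map_mul x y v

/-- `φ` embeds in `ψ`: some submodule of `ψ` is isomorphic to `φ`. -/
def EmbedsIn {W : Type*} [AddCommGroup W] [Module ℂ W]
    (φ : CocycleRep α V) (ψ : CocycleRep α W) : Prop :=
  ∃ f : V →ₗ[ℂ] W, Function.Injective f ∧ ∀ (g : G) (v : V), f (φ.toFun g v) = ψ.toFun g (f v)

/-- The module `ψ` of `G` lies over the (irreducible) module `φ` of the subgroup `N`: the
restriction of `ψ` to `N` has `φ` as a constituent. -/
def LiesOver {N : Subgroup G} {X : Type*} [AddCommGroup X] [Module ℂ X]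
    (ψ : CocycleRep α X) (φ : CocycleRep (resZ2 N α) V) : Prop :=
  φ.EmbedsIn (ψ.res N)

end CocycleRep

/-- `Π(n)`: the set of prime divisors of `n`. -/
def primeDivisors (n : ℕ) : Set ℕ := {p | p.Prime ∧ p ∣ n}

/-- `π'`: the complement of `π` in the set of all primes. -/
def primeCompl (π : Set ℕ) : Set ℕ := {p | p.Prime ∧ p ∉ π}

/-- `M / N` is a `π`-factor of `G`: `N ≤ M` are normal subgroups of `G` and every prime divisor of
`|M / N|` lies in `π`. -/
structure IsPiFactor {G : Type*} [Group G] (π : Set ℕ) (M N : Subgroup G) : Prop where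
  normal_top : M.Normal
  normal_bot : N.Normal
  le : N ≤ M
  primeDivisors_subset : primeDivisors (Nat.card (M ⧸ N.subgroupOf M)) ⊆ π

end ProjectiveRep

/-! An irreducible module `Z` of `M` over `V` lies below an irreducible module of `G`, whose degree
`dim Z` divides by Clifford theory. So `dim Z` is coprime to `|M/N|`, and one may work in `M` alone
(there called `G`).

Coprimality makes `Z` restrict irreducibly to `N` (`IsIrreducible.finrank_eq_of_coprime`). The
isotypic components of the restriction form one orbit, whose length divides both `dim Z` and the
index, so there is only one and `Z ≅ V^e`. By Schur's lemma `g` acts as `b(g) ⊗ A(g)`, with `b` an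
absolutely irreducible projective representation of the quotient. Its degree `e` divides the index
(`Matrix.card_dvd_card_of_projective`) and `dim Z`, so `e = 1`.

Hence `V` extends to a module `ρ`, and every irreducible module over `V` has degree `dim V`. Every
irreducible quotient of `ρ ⊗ ℂ[M/N]` restricts to `V` on `N`, so Schur's lemma forces the second
factor to act through commuting scalars. Such quotients separate points by Maschke's theorem, so
`ab` and `ba` cannot be distinct basis elements of `ℂ[M/N]`
(`IsIrreducible.quotient_comm_of_coprime`). -/

namespace ProjectiveRep
namespace CocycleRep

variable {G : Type*} [Group G] {α : Z2 G} {V : Type*} [AddCommGroup V] [Module ℂ V]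
  {W : Type*} [AddCommGroup W] [Module ℂ W]

/-! ### Invariant subspaces, Schur's lemma and Maschke's theorem -/

/-- A subspace is invariant under a projective representation. -/
def IsInv (φ : CocycleRep α V) (U : Submodule ℂ V) : Prop :=
  ∀ (g : G), ∀ v ∈ U, φ.toFun g v ∈ U

/-- Linear maps commuting with the actions. -/
def IsHom (φ : CocycleRep α V) (ψ : CocycleRep α W) (f : V →ₗ[ℂ] W) : Prop :=
  ∀ (g : G) (v : V), f (φ.toFun g v) = ψ.toFun g (f v)

theorem map_one_apply (φ : CocycleRep α V) (v : V) :
    φ.toFun 1 v = (((α : G → G → ℂˣ) 1 1 : ℂˣ) : ℂ) • v := by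
  apply (φ.toFun 1).injective
  rw [φ.map_mul, mul_one, map_smul]

theorem map_mul_symm (φ : CocycleRep α V) (x y : G) (v : V) :
    φ.toFun (x * y) v
      = (((α : G → G → ℂˣ) x y : ℂˣ) : ℂ)⁻¹ • φ.toFun x (φ.toFun y v) := by
  rw [φ.map_mul, smul_smul, inv_mul_cancel₀ (Units.ne_zero _), one_smul]

/-- Since `φ(g) φ(g⁻¹)` is the scalar `α(g, g⁻¹) α(1, 1)`, invariance under the operators passes to
their inverses without any finiteness assumption. -/
theorem symm_apply (φ : CocycleRep α V) (g : G) (v : V) :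
    (φ.toFun g).symm v
      = ((((α : G → G → ℂˣ) g g⁻¹ * (α : G → G → ℂˣ) 1 1 : ℂˣ) : ℂ))⁻¹ • φ.toFun g⁻¹ v := by
  rw [LinearEquiv.symm_apply_eq, map_smul, φ.map_mul, mul_inv_cancel, map_one_apply, smul_smul,
    smul_smul, Units.val_mul, mul_assoc, inv_mul_cancel₀]
  · simp
  · exact mul_ne_zero (Units.ne_zero _) (Units.ne_zero _)

theorem IsInv.symm_mem {φ : CocycleRep α V} {U : Submodule ℂ V} (hU : φ.IsInv U) (g : G)
    {v : V} (hv : v ∈ U) : (φ.toFun g).symm v ∈ U := by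
  rw [symm_apply]
  exact U.smul_mem _ (hU _ _ hv)

theorem IsInv.map_eq {φ : CocycleRep α V} {U : Submodule ℂ V} (hU : φ.IsInv U) (g : G) :
    U.map (φ.toFun g : V →ₗ[ℂ] V) = U := by
  apply le_antisymm
  · rintro _ ⟨v, hv, rfl⟩
    exact hU g v hv
  · intro v hv
    exact ⟨(φ.toFun g).symm v, hU.symm_mem g hv, by simp⟩

theorem IsHom.isInv_ker {φ : CocycleRep α V} {ψ : CocycleRep α W} {f : V →ₗ[ℂ] W}
    (hf : φ.IsHom ψ f) : φ.IsInv (LinearMap.ker f) := by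
  intro g v hv
  rw [LinearMap.mem_ker] at hv ⊢
  rw [hf, hv, map_zero]

theorem IsHom.isInv_range {φ : CocycleRep α V} {ψ : CocycleRep α W} {f : V →ₗ[ℂ] W}
    (hf : φ.IsHom ψ f) : ψ.IsInv (LinearMap.range f) := by
  rintro g _ ⟨v, rfl⟩
  exact ⟨φ.toFun g v, hf g v⟩

theorem IsIrreducible.injective {φ : CocycleRep α V} (hφ : φ.IsIrreducible)
    {ψ : CocycleRep α W} {f : V →ₗ[ℂ] W} (hf : φ.IsHom ψ f) (h0 : f ≠ 0) :
    Function.Injective f := by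
  rcases hφ.2 _ hf.isInv_ker with h | h
  · exact LinearMap.ker_eq_bot.1 h
  · exact absurd (LinearMap.ker_eq_top.1 h) h0

theorem IsIrreducible.finrank_pos [FiniteDimensional ℂ V] {φ : CocycleRep α V}
    (hφ : φ.IsIrreducible) : 0 < Module.finrank ℂ V :=
  have := hφ.1
  Module.finrank_pos

/-- Schur's lemma. -/
theorem IsIrreducible.exists_smul [FiniteDimensional ℂ V] {φ : CocycleRep α V}
    (hφ : φ.IsIrreducible) {T : V →ₗ[ℂ] V} (hT : φ.IsHom φ T) : ∃ c : ℂ, ∀ v, T v = c • v := by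
  have := hφ.1
  obtain ⟨c, hc⟩ := Module.End.exists_eigenvalue T
  refine ⟨c, ?_⟩
  have hinv : φ.IsInv (Module.End.eigenspace T c) := by
    intro g v hv
    rw [Module.End.mem_eigenspace_iff] at hv ⊢
    rw [hT, hv, map_smul]
  rcases hφ.2 _ hinv with h | h
  · exact absurd h hc
  · intro v
    exact Module.End.mem_eigenspace_iff.1 (h ▸ Submodule.mem_top)

/-- Maschke's theorem. -/
theorem IsInv.exists_isCompl [Finite G] {φ : CocycleRep α V} {U : Submodule ℂ V}
    (hU : φ.IsInv U) : ∃ U', φ.IsInv U' ∧ IsCompl U U' := by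
  classical
  have := Fintype.ofFinite G
  obtain ⟨p, hp⟩ := U.subtype.exists_leftInverse_of_injective U.ker_subtype
  have hp' : ∀ v (hv : v ∈ U), p v = ⟨v, hv⟩ := fun v hv =>
    congrArg (fun f => f ⟨v, hv⟩) hp
  let q : V →ₗ[ℂ] V := U.subtype ∘ₗ p
  -- The average of the conjugates of a projection onto `U`; cocycle values cancel in a conjugation,
  -- so it commutes with the action.
  let P : V →ₗ[ℂ] V := (Fintype.card G : ℂ)⁻¹ •
    ∑ g : G, (φ.toFun g : V →ₗ[ℂ] V) ∘ₗ q ∘ₗ ((φ.toFun g).symm : V →ₗ[ℂ] V)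
  have hPapp : ∀ v, P v = (Fintype.card G : ℂ)⁻¹ •
      ∑ g : G, φ.toFun g (q ((φ.toFun g).symm v)) := by
    intro v; simp [P]
  have hcard : (Fintype.card G : ℂ) ≠ 0 := by exact_mod_cast Fintype.card_ne_zero
  have hPmem : ∀ v, P v ∈ U := fun v => by
    rw [hPapp]
    exact U.smul_mem _ (U.sum_mem fun g _ => hU _ _ (p _).2)
  have hPid : ∀ v ∈ U, P v = v := fun v hv => by
    rw [hPapp]
    have : ∀ g : G, φ.toFun g (q ((φ.toFun g).symm v)) = v := fun g => by
      simp only [q, LinearMap.comp_apply, hp' _ (hU.symm_mem g hv)]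
      simp
    simp [this, ← Nat.cast_smul_eq_nsmul ℂ, smul_smul, hcard]
  have hPcomm : ∀ (h : G) (v : V), P (φ.toFun h v) = φ.toFun h (P v) := by
    intro h v
    rw [hPapp, hPapp, map_smul, map_sum]
    congr 1
    rw [← Equiv.sum_comp (Equiv.mulLeft h)]
    refine Finset.sum_congr rfl fun g _ => ?_
    simp only [Equiv.coe_mulLeft]
    have h1 : (φ.toFun (h * g)).symm (φ.toFun h v)
        = (((α : G → G → ℂˣ) h g : ℂˣ) : ℂ) • (φ.toFun g).symm v := by
      rw [LinearEquiv.symm_apply_eq, map_smul, ← φ.map_mul]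
      simp
    rw [h1, map_smul, map_smul, ← φ.map_mul]
  refine ⟨LinearMap.ker P, ?_, LinearMap.IsProj.isCompl ⟨hPmem, hPid⟩⟩
  intro g v hv
  rw [LinearMap.mem_ker] at hv ⊢
  rw [hPcomm, hv, map_zero]

/-! ### The operator algebra and irreducible quotients -/

/-- The algebra of operators generated by a projective representation. -/
def OpAlg (φ : CocycleRep α V) : Type _ :=
  Algebra.adjoin ℂ (Set.range fun g => (φ.toFun g : Module.End ℂ V))

namespace OpAlg

noncomputable instance (φ : CocycleRep α V) : Ring φ.OpAlg :=
  inferInstanceAs (Ring (Algebra.adjoin ℂ (Set.range fun g => (φ.toFun g : Module.End ℂ V))))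

noncomputable instance (φ : CocycleRep α V) : Algebra ℂ φ.OpAlg :=
  inferInstanceAs (Algebra ℂ (Algebra.adjoin ℂ (Set.range fun g => (φ.toFun g : Module.End ℂ V))))

noncomputable instance (φ : CocycleRep α V) : Module φ.OpAlg V :=
  inferInstanceAs
    (Module (Algebra.adjoin ℂ (Set.range fun g => (φ.toFun g : Module.End ℂ V))) V)

instance (φ : CocycleRep α V) : IsScalarTower ℂ φ.OpAlg V :=
  inferInstanceAs
    (IsScalarTower ℂ (Algebra.adjoin ℂ (Set.range fun g => (φ.toFun g : Module.End ℂ V))) V)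

end OpAlg

/-- The generator of the operator algebra given by a group element. -/
def gen (φ : CocycleRep α V) (g : G) : φ.OpAlg :=
  ⟨(φ.toFun g : V →ₗ[ℂ] V), Algebra.subset_adjoin ⟨g, rfl⟩⟩

theorem OpAlg.induction {φ : CocycleRep α V} {p : φ.OpAlg → Prop} (hgen : ∀ g, p (φ.gen g))
    (hscalar : ∀ c : ℂ, p (algebraMap ℂ φ.OpAlg c)) (hadd : ∀ a b, p a → p b → p (a + b))
    (hmul : ∀ a b, p a → p b → p (a * b)) (r : φ.OpAlg) : p r := by
  obtain ⟨a, ha⟩ := r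
  induction ha using Algebra.adjoin_induction with
  | mem x hx => obtain ⟨g, rfl⟩ := hx; exact hgen g
  | algebraMap c => exact hscalar c
  | add x y hx hy h1 h2 => exact hadd ⟨x, hx⟩ ⟨y, hy⟩ h1 h2
  | mul x y hx hy h1 h2 => exact hmul ⟨x, hx⟩ ⟨y, hy⟩ h1 h2

/-- An invariant subspace as a submodule over the operator algebra. -/
def IsInv.toAlg {φ : CocycleRep α V} {U : Submodule ℂ V} (hU : φ.IsInv U) :
    Submodule φ.OpAlg V where
  carrier := U
  add_mem' := U.add_mem
  zero_mem' := U.zero_mem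
  smul_mem' r := by
    induction r using OpAlg.induction with
    | hgen g => exact fun {v} hv => hU g v hv
    | hscalar c =>
      intro v hv
      rw [algebraMap_smul]
      exact U.smul_mem c hv
    | hadd a b h1 h2 =>
      intro v hv
      rw [add_smul]
      exact U.add_mem (h1 hv) (h2 hv)
    | hmul a b h1 h2 =>
      intro v hv
      rw [mul_smul]
      exact h1 (h2 hv)

@[simp] theorem IsInv.mem_toAlg {φ : CocycleRep α V} {U : Submodule ℂ V} (hU : φ.IsInv U)
    (v : V) : v ∈ hU.toAlg ↔ v ∈ U := Iff.rfl

theorem isInv_restrictScalars (φ : CocycleRep α V) (U : Submodule φ.OpAlg V) :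
    φ.IsInv (U.restrictScalars ℂ) := fun g _ hv => U.smul_mem (φ.gen g) hv

/-- Maschke's theorem in module language, giving access to the Jacobson radical and isotypic
components. -/
theorem isSemisimpleModule_opAlg [Finite G] (φ : CocycleRep α V) :
    IsSemisimpleModule φ.OpAlg V := by
  rw [isSemisimpleModule_iff]
  refine ⟨fun U => ?_⟩
  obtain ⟨C, hC, hUC⟩ := (φ.isInv_restrictScalars U).exists_isCompl
  refine ⟨hC.toAlg, ?_⟩
  rw [isCompl_iff, Submodule.disjoint_def, codisjoint_iff, Submodule.eq_top_iff'] at hUC ⊢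
  refine ⟨fun x hx hx' => hUC.1 x hx hx', fun x => ?_⟩
  obtain ⟨a, ha, b, hb, h⟩ := Submodule.mem_sup.1 (hUC.2 x)
  exact Submodule.mem_sup.2 ⟨a, ha, b, hb, h⟩

/-- Transport along a linear equivalence. -/
def congr (φ : CocycleRep α V) (e : V ≃ₗ[ℂ] W) : CocycleRep α W where
  toFun g := e.symm.trans ((φ.toFun g).trans e)
  map_mul x y v := by simp [φ.map_mul]

theorem isHom_congr (φ : CocycleRep α V) (e : V ≃ₗ[ℂ] W) :
    φ.IsHom (φ.congr e) (e : V →ₗ[ℂ] W) := by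
  intro g v; simp [congr]

theorem IsIrreducible.congr {φ : CocycleRep α V} (hφ : φ.IsIrreducible) (e : V ≃ₗ[ℂ] W) :
    (φ.congr e).IsIrreducible := by
  have := hφ.1
  refine ⟨e.symm.toEquiv.nontrivial, fun U hU => ?_⟩
  have hinv : φ.IsInv (U.comap (e : V →ₗ[ℂ] W)) := by
    intro g v hv
    have := hU g _ hv
    simpa [CocycleRep.congr] using this
  rcases hφ.2 _ hinv with h | h
  · left
    rw [eq_bot_iff]
    intro w hw
    have : e.symm w ∈ U.comap (e : V →ₗ[ℂ] W) := by simpa using hw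
    rw [h] at this
    simpa using this
  · right
    rw [eq_top_iff]
    intro w _
    have : e.symm w ∈ U.comap (e : V →ₗ[ℂ] W) := h ▸ Submodule.mem_top
    simpa using this

/-- The quotient by an invariant subspace. -/
def quotient (φ : CocycleRep α V) {U : Submodule ℂ V} (hU : φ.IsInv U) :
    CocycleRep α (V ⧸ U) where
  toFun g := Submodule.Quotient.equiv U U (φ.toFun g) (hU.map_eq g)
  map_mul x y v := by
    induction v using Submodule.Quotient.induction_on with
    | H v =>
      simp only [Submodule.Quotient.equiv_apply, Submodule.mapQ_apply, LinearEquiv.coe_coe,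
        φ.map_mul, Submodule.Quotient.mk_smul]

theorem isHom_mkQ (φ : CocycleRep α V) {U : Submodule ℂ V} (hU : φ.IsInv U) :
    φ.IsHom (φ.quotient hU) U.mkQ := fun _ _ => rfl

/-- Every nonzero vector has nonzero image in some irreducible quotient. -/
theorem exists_irreducible_quotient [Finite G] [FiniteDimensional ℂ V] (φ : CocycleRep α V)
    {v : V} (hv : v ≠ 0) :
    ∃ (n : ℕ) (ψ : CocycleRep α (Fin n → ℂ)) (p : V →ₗ[ℂ] (Fin n → ℂ)),
      ψ.IsIrreducible ∧ φ.IsHom ψ p ∧ p v ≠ 0 := by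
  have := φ.isSemisimpleModule_opAlg
  -- Maximal submodules of a semisimple module intersect in zero, so one of them misses `v`.
  have hj : v ∉ Module.jacobson φ.OpAlg V := by
    rw [IsSemisimpleModule.jacobson_eq_bot]
    simpa using hv
  obtain ⟨m, hm, hvm⟩ : ∃ m : Submodule φ.OpAlg V, IsCoatom m ∧ v ∉ m := by
    by_contra! hcon
    exact hj (by simpa [Module.jacobson, Submodule.mem_sInf] using hcon)
  have hinv := φ.isInv_restrictScalars m
  set U := m.restrictScalars ℂ with hUdef
  have hirr : (φ.quotient hinv).IsIrreducible := by
    constructor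
    · refine ⟨⟨U.mkQ v, 0, ?_⟩⟩
      simpa [hUdef] using hvm
    · intro X hX
      have hXinv : φ.IsInv (X.comap U.mkQ) := fun g w hw => hX g _ hw
      have hle : m ≤ hXinv.toAlg := fun w hw => by
        rw [IsInv.mem_toAlg, Submodule.mem_comap]
        have : U.mkQ w = 0 := by simpa [hUdef] using hw
        rw [this]
        exact X.zero_mem
      rcases hm.le_iff.1 hle with h | h
      · right
        rw [eq_top_iff]
        intro x _
        obtain ⟨w, rfl⟩ := U.mkQ_surjective x
        have : w ∈ hXinv.toAlg := h ▸ Submodule.mem_top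
        exact this
      · left
        rw [eq_bot_iff]
        intro x hx
        obtain ⟨w, rfl⟩ := U.mkQ_surjective x
        have : w ∈ hXinv.toAlg := hx
        rw [h] at this
        simpa [hUdef] using this
  -- Coordinates place the quotient in `Type`, whatever the universe of `V`.
  let e := (Module.finBasis ℂ (V ⧸ U)).equivFun
  refine ⟨_, (φ.quotient hinv).congr e, (e : _ →ₗ[ℂ] _) ∘ₗ U.mkQ, hirr.congr e, ?_, ?_⟩
  · intro g w
    rw [LinearMap.comp_apply, LinearMap.comp_apply, ← isHom_congr, ← isHom_mkQ]
  · simpa [hUdef] using hvm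

/-! ### Modules of a group above and below modules of a subgroup -/

/-- The twisted right regular representation on functions. -/
def regular (α : Z2 G) (V : Type*) [AddCommGroup V] [Module ℂ V] : CocycleRep α (G → V) where
  toFun g :=
    { toFun := fun F x => (α : G → G → ℂˣ) x g • F (x * g)
      invFun := fun F x => ((α : G → G → ℂˣ) (x * g⁻¹) g)⁻¹ • F (x * g⁻¹)
      map_add' := by intro F F'; ext x; simp
      map_smul' := by intro c F; ext x; simp [smul_comm c]
      left_inv := by intro F; ext x; simp
      right_inv := by intro F; ext x; simp }
  map_mul x y F := by
    ext z
    have h := α.2 z x y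
    simp only [LinearEquiv.coe_mk, LinearMap.coe_mk, AddHom.coe_mk, Pi.smul_apply, mul_assoc]
    rw [← Units.smul_def, smul_smul, smul_smul, h]

/-- Sending `v` to the function `x ↦ φ(x) v` on `H`, zero off `H`, maps `φ` into the regular module.
An irreducible quotient in which some image survives contains `φ`, which has no proper kernel. -/
theorem exists_irreducible_liesOver [Finite G] [FiniteDimensional ℂ V] {H : Subgroup G}
    {φ : CocycleRep (resZ2 H α) V} (hφ : φ.IsIrreducible) :
    ∃ (n : ℕ) (ψ : CocycleRep α (Fin n → ℂ)), ψ.IsIrreducible ∧ ψ.LiesOver φ := by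
  classical
  let f : V →ₗ[ℂ] (G → V) :=
    LinearMap.pi fun x => if hx : x ∈ H then (φ.toFun ⟨x, hx⟩ : V →ₗ[ℂ] V) else 0
  have hfapp : ∀ v x, f v x = if hx : x ∈ H then φ.toFun ⟨x, hx⟩ v else 0 := by
    intro v x
    simp only [f, LinearMap.pi_apply]
    split_ifs <;> rfl
  have hf : φ.IsHom ((regular α V).res H) f := by
    intro h v
    ext x
    have hR : ((regular α V).res H).toFun h (f v) x
        = (α : G → G → ℂˣ) x h • f v (x * h) := rfl
    rw [hR, hfapp, hfapp]
    by_cases hx : x ∈ H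
    · rw [dif_pos hx, dif_pos (H.mul_mem hx h.2), φ.map_mul]
      rfl
    · rw [dif_neg hx, dif_neg (fun hxh => hx ((H.mul_mem_cancel_right h.2).1 hxh)), smul_zero]
  have := hφ.1
  obtain ⟨v, hv⟩ := exists_ne (0 : V)
  have hfv : f v ≠ 0 := fun h0 => hv <| by
    have := congrFun h0 1
    rw [hfapp, dif_pos H.one_mem] at this
    simpa using this
  obtain ⟨n, ψ, p, hψ, hp, hpv⟩ := (regular α V).exists_irreducible_quotient hfv
  have hpf : φ.IsHom (ψ.res H) (p ∘ₗ f) := by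
    intro h v
    rw [LinearMap.comp_apply, hf]
    exact hp _ _
  exact ⟨n, ψ, hψ, p ∘ₗ f, hφ.injective hpf fun h0 => hpv (congrArg (fun T => T v) h0), hpf⟩

/-- The degree of an irreducible constituent of the restriction to a normal subgroup divides the
degree. -/
theorem IsIrreducible.finrank_dvd_of_liesOver [Finite G] [FiniteDimensional ℂ V]
    [FiniteDimensional ℂ W] {H : Subgroup G} [hH : H.Normal]
    {φ : CocycleRep (resZ2 H α) V} (hφ : φ.IsIrreducible)
    {ψ : CocycleRep α W} (hψ : ψ.IsIrreducible) (h : ψ.LiesOver φ) :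
    Module.finrank ℂ V ∣ Module.finrank ℂ W := by
  classical
  have := Fintype.ofFinite G
  obtain ⟨f, hfi, hf⟩ := h
  let T : G → Submodule ℂ W := fun g => (LinearMap.range f).map (ψ.toFun g : W →ₗ[ℂ] W)
  have hTdim : ∀ g, Module.finrank ℂ (T g) = Module.finrank ℂ V := fun g => by
    rw [← LinearMap.finrank_range_of_inj hfi]
    exact LinearEquiv.finrank_map_eq (ψ.toFun g) _
  have hTinv : ∀ g, (ψ.res H).IsInv (T g) := by
    rintro g k _ ⟨_, ⟨v, rfl⟩, rfl⟩
    let k' : H := ⟨g⁻¹ * k * g, by simpa using hH.conj_mem k k.2 g⁻¹⟩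
    have e : (k : G) * g = g * k' := by simp [k', mul_assoc]
    change ψ.toFun k (ψ.toFun g (f v)) ∈ T g
    rw [ψ.map_mul, e, map_mul_symm]
    have e2 : ψ.toFun (k' : G) (f v) = f (φ.toFun k' v) := (hf k' v).symm
    rw [e2]
    exact (T g).smul_mem _ ((T g).smul_mem _ ⟨_, ⟨_, rfl⟩, rfl⟩)
  -- Pulling `U` back along `v ↦ ψ(g) f(v)` gives an `H`-invariant subspace of the irreducible `V`.
  have hTsimple : ∀ g, ∀ U, (ψ.res H).IsInv U → U ⊓ T g = ⊥ ∨ T g ≤ U := by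
    intro g U hU
    let f' : V →ₗ[ℂ] W := (ψ.toFun g : W →ₗ[ℂ] W) ∘ₗ f
    have hinv : φ.IsInv (U.comap f') := by
      intro k v hv
      let k' : H := ⟨g * k * g⁻¹, hH.conj_mem k k.2 g⟩
      have e : g * (k : G) = k' * g := by simp [k', mul_assoc]
      change ψ.toFun g (f (φ.toFun k v)) ∈ U
      have e2 : f (φ.toFun k v) = ψ.toFun (k : G) (f v) := hf k v
      rw [e2, ψ.map_mul, e, map_mul_symm]
      exact U.smul_mem _ (U.smul_mem _ (hU k' _ hv))
    rcases hφ.2 _ hinv with h | h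
    · left
      rw [eq_bot_iff]
      rintro _ ⟨hU', ⟨_, ⟨v, rfl⟩, rfl⟩⟩
      have : v ∈ U.comap f' := hU'
      rw [h, Submodule.mem_bot] at this
      simp [this]
    · right
      rintro _ ⟨_, ⟨v, rfl⟩, rfl⟩
      have : v ∈ U.comap f' := h ▸ Submodule.mem_top
      exact this
  -- Adding one translate raises the dimension by `0` or by `dim V`; the sum of all translates is
  -- `W`.
  have key : ∀ s : Finset G, (ψ.res H).IsInv (s.sup T) ∧
      Module.finrank ℂ V ∣ Module.finrank ℂ (s.sup T : Submodule ℂ W) := by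
    intro s
    induction s using Finset.induction_on with
    | empty =>
      refine ⟨fun k v hv => ?_, by rw [Finset.sup_empty, finrank_bot]; exact dvd_zero _⟩
      simp only [Finset.sup_empty, Submodule.mem_bot] at hv ⊢
      rw [hv, map_zero]
    | insert g s _ ih =>
      rw [Finset.sup_insert, sup_comm]
      constructor
      · intro k v hv
        obtain ⟨a, ha, b, hb, rfl⟩ := Submodule.mem_sup.1 hv
        rw [map_add]
        exact Submodule.mem_sup.2 ⟨_, ih.1 k a ha, _, hTinv g k b hb, rfl⟩
      · rcases hTsimple g _ ih.1 with h | h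
        · have := Submodule.finrank_sup_add_finrank_inf_eq (s.sup T) (T g)
          rw [h, finrank_bot, add_zero, hTdim] at this
          rw [this]
          exact (Nat.dvd_add_right ih.2).2 dvd_rfl
        · rw [sup_eq_left.2 h]
          exact ih.2
  have hG : ψ.IsInv ((Finset.univ : Finset G).sup T) := by
    intro g w hw
    have hmap : ((Finset.univ : Finset G).sup T).map (ψ.toFun g : W →ₗ[ℂ] W)
        ≤ (Finset.univ : Finset G).sup T := by
      rw [Finset.sup_univ_eq_iSup, Submodule.map_iSup]
      refine iSup_le fun x => le_trans ?_ (le_iSup T (g * x))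
      rintro _ ⟨_, ⟨w, hw, rfl⟩, rfl⟩
      change ψ.toFun g (ψ.toFun x w) ∈ _
      rw [ψ.map_mul]
      exact Submodule.smul_mem _ _ ⟨w, hw, rfl⟩
    exact hmap ⟨w, hw, rfl⟩
  rcases hψ.2 _ hG with h | h
  · exfalso
    have h1 : T 1 ≤ ⊥ := h ▸ Finset.le_sup (Finset.mem_univ _)
    have h2 := hTdim 1
    rw [le_bot_iff.1 h1, finrank_bot] at h2
    exact hφ.finrank_pos.ne h2
  · have := (key Finset.univ).2
    rwa [h, finrank_top] at this

end CocycleRep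
end ProjectiveRep

/-! ### The degree of an irreducible projective representation divides the group order -/

open scoped Kronecker in
/-- An absolutely irreducible projective matrix representation of a finite group, normalised to
have determinant one, has degree dividing the group order. -/
theorem Matrix.card_dvd_card_of_projective_of_det_eq_one {Q : Type*} [Group Q] [Finite Q]
    {n : Type*} [Fintype n] [DecidableEq n] [Nonempty n] (B : Q → Matrix n n ℂ)
    (hdet : ∀ a, (B a).det = 1) (hB : ∀ a b, ∃ c : ℂ, B a * B b = c • B (a * b))
    (hcomm : ∀ T : Matrix n n ℂ, (∀ a, B a * T = T * B a) → ∃ c : ℂ, T = c • 1) :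
    Fintype.card n ∣ Nat.card Q := by
  classical
  have := Fintype.ofFinite Q
  set e := Fintype.card n with he
  have he0 : (e : ℂ) ≠ 0 := by exact_mod_cast Fintype.card_ne_zero
  have hunit : ∀ a, IsUnit (B a).det := fun a => by rw [hdet]; exact isUnit_one
  choose c hc using hB
  -- Determinant one makes the multipliers `e`-th roots of unity; this is what keeps `Γ` below
  -- finite.
  have hce : ∀ a b, c a b ^ e = 1 := fun a b => by
    have := congrArg Matrix.det (hc a b)
    rw [Matrix.det_mul, Matrix.det_smul, hdet, hdet, hdet] at this
    simpa using this.symm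
  have hepos : e ≠ 0 := Fintype.card_ne_zero
  have hc0 : ∀ a b, c a b ≠ 0 := fun a b h => by
    have := hce a b
    rw [h, zero_pow hepos] at this
    exact zero_ne_one this
  have hone : B 1 = c 1 1 • 1 := by
    have h := hc 1 1
    rw [mul_one] at h
    have h' := congrArg (fun M => M * (B 1)⁻¹) h
    simpa [Matrix.mul_assoc, Matrix.mul_nonsing_inv _ (hunit 1)] using h'
  have hinv : ∀ a, (B a)⁻¹ = (c a a⁻¹ * c 1 1)⁻¹ • B a⁻¹ := fun a => by
    apply Matrix.inv_eq_right_inv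
    rw [Matrix.mul_smul, hc, mul_inv_cancel, hone, smul_smul, smul_smul, mul_assoc,
      inv_mul_cancel₀, one_smul]
    exact mul_ne_zero (hc0 _ _) (hc0 _ _)
  set r : ℂ := (Fintype.card Q : ℂ) / e with hr
  -- The average commutes with every `B b`, hence is scalar; its trace determines the scalar.
  have hschur : ∀ T : Matrix n n ℂ,
      ∑ a, B a * T * (B a)⁻¹ = (r * T.trace) • 1 := by
    intro T
    obtain ⟨s, hs⟩ := hcomm (∑ a, B a * T * (B a)⁻¹) (fun b => by
      rw [Finset.mul_sum, Finset.sum_mul, ← Equiv.sum_comp (Equiv.mulLeft b)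
        (fun a => B a * T * (B a)⁻¹ * B b)]
      refine Finset.sum_congr rfl fun a _ => ?_
      simp only [Equiv.coe_mulLeft]
      have h1 : (B (b * a))⁻¹ * B b = c b a • (B a)⁻¹ := by
        have h2 : B b = c b a • (B (b * a) * (B a)⁻¹) := by
          rw [← Matrix.smul_mul, ← hc, Matrix.mul_assoc, Matrix.mul_nonsing_inv _ (hunit a),
            Matrix.mul_one]
        conv_lhs => rw [h2]
        rw [Matrix.mul_smul, ← Matrix.mul_assoc, Matrix.nonsing_inv_mul _ (hunit _),
          Matrix.one_mul]
      rw [Matrix.mul_assoc (B (b * a) * T), h1, Matrix.mul_assoc (B a), ← Matrix.mul_assoc (B b),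
        hc, Matrix.smul_mul, Matrix.mul_smul, Matrix.mul_assoc])
    have htr := congrArg Matrix.trace hs
    rw [Matrix.trace_sum] at htr
    have h3 : ∀ a, (B a * T * (B a)⁻¹).trace = T.trace := fun a => by
      rw [Matrix.trace_mul_comm, ← Matrix.mul_assoc, Matrix.nonsing_inv_mul _ (hunit _),
        Matrix.one_mul]
    simp only [h3, Finset.sum_const, Finset.card_univ, nsmul_eq_mul, Matrix.trace_smul,
      Matrix.trace_one, smul_eq_mul] at htr
    rw [hs]
    congr 1
    rw [hr, div_mul_eq_mul_div, htr, mul_div_assoc, div_self he0, mul_one]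
  -- Evaluating `hschur` on matrix units shows that `C` is `r` times the swap of the tensor factors,
  -- so `C² = r²`.
  set C : Matrix (n × n) (n × n) ℂ := ∑ a, B a ⊗ₖ (B a)⁻¹ with hC
  have hCentry : ∀ i k j l, C (i, k) (j, l) = if i = l ∧ j = k then r else 0 := by
    intro i k j l
    have h := congrFun (congrFun (hschur (Matrix.single j k 1)) i) l
    have h4 : ∀ a, (B a * Matrix.single j k 1 * (B a)⁻¹ : Matrix n n ℂ) i l
        = B a i j * (B a)⁻¹ k l := fun a => by
      rw [Matrix.mul_apply, Finset.sum_eq_single k]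
      · simp
      · intro m _ hm
        simp [Matrix.mul_single_apply_of_ne, hm]
      · simp
    rw [Matrix.sum_apply] at h
    simp only [h4] at h
    have h5 : C (i, k) (j, l) = ∑ a, B a i j * (B a)⁻¹ k l := by
      rw [hC, Matrix.sum_apply]
      rfl
    rw [h5, h]
    by_cases hjk : j = k
    · subst hjk
      by_cases hil : i = l <;> simp [hil]
    · simp [Matrix.trace_single_eq_of_ne, hjk]
  have hCC : C * C = (r ^ 2) • 1 := by
    ext ⟨i, k⟩ ⟨j, l⟩
    rw [Matrix.mul_apply, Finset.sum_eq_single (k, i)]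
    · rw [hCentry, hCentry]
      by_cases h1 : k = l <;> by_cases h2 : i = j <;>
        simp [h1, h2, eq_comm, pow_two]
    · rintro ⟨x, y⟩ _ hxy
      rw [hCentry, if_neg, zero_mul]
      rintro ⟨rfl, rfl⟩
      exact hxy rfl
    · simp
  let Γ : Submonoid (Matrix (n × n) (n × n) ℂ) :=
    { carrier := {x | ∃ (a b : Q) (z : ℂ), z ^ e = 1 ∧ x = z • (B a ⊗ₖ B b)}
      one_mem' := by
        refine ⟨1, 1, (c 1 1)⁻¹ * (c 1 1)⁻¹, by rw [mul_pow, inv_pow, hce]; simp, ?_⟩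
        rw [hone, Matrix.smul_kronecker, Matrix.kronecker_smul, smul_smul, smul_smul,
          Matrix.one_kronecker_one]
        field_simp [hc0 1 1]
        simp
      mul_mem' := by
        rintro _ _ ⟨a, b, z, hz, rfl⟩ ⟨a', b', z', hz', rfl⟩
        refine ⟨a * a', b * b', z * z' * c a a' * c b b', by simp [mul_pow, hz, hz', hce], ?_⟩
        rw [Matrix.smul_mul, Matrix.mul_smul, ← Matrix.mul_kronecker_mul, hc, hc,
          Matrix.smul_kronecker, Matrix.kronecker_smul]
        simp only [smul_smul]
        ring_nf }
  have hΓfin : (Γ : Set (Matrix (n × n) (n × n) ℂ)).Finite := by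
    have hroots : {z : ℂ | z ^ e = 1}.Finite :=
      (Polynomial.nthRootsFinset e (1 : ℂ)).finite_toSet.subset fun z hz => by
        simpa [Polynomial.mem_nthRootsFinset (Nat.pos_of_ne_zero hepos)] using hz
    have := ((Set.finite_univ (α := Q × Q)).prod hroots).image
      (fun x : (Q × Q) × ℂ => x.2 • (B x.1.1 ⊗ₖ B x.1.2))
    refine this.subset ?_
    rintro _ ⟨a, b, z, hz, rfl⟩
    exact ⟨((a, b), z), ⟨trivial, hz⟩, rfl⟩
  -- `C` lies in the ring spanned over `ℤ` by the finite monoid `Γ`, as each `(B a)⁻¹` is a root of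
  -- unity times `B a⁻¹`. So `r`, a rational number, is an algebraic integer.
  have hCint : IsIntegral ℤ C := by
    refine IsIntegral.of_mem_of_fg (Algebra.adjoin ℤ (Γ : Set _)) ?_ C ?_
    · rw [Algebra.adjoin_eq_span, Submonoid.closure_eq]
      exact Submodule.fg_span hΓfin
    · refine sum_mem fun a _ => Algebra.subset_adjoin ?_
      refine ⟨a, a⁻¹, (c a a⁻¹ * c 1 1)⁻¹, by simp [mul_pow, hce], ?_⟩
      rw [hinv, Matrix.kronecker_smul]
  have hr2 : IsIntegral ℤ (r ^ 2) := by
    have h5 : IsIntegral ℤ (algebraMap ℂ (Matrix (n × n) (n × n) ℂ) (r ^ 2)) := by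
      rw [Algebra.algebraMap_eq_smul_one, ← hCC, ← pow_two]
      exact hCint.pow 2
    exact (isIntegral_algebraMap_iff (algebraMap ℂ (Matrix (n × n) (n × n) ℂ)).injective).1 h5
  have hrint : IsIntegral ℤ r := IsIntegral.of_pow two_pos hr2
  have hq : IsIntegral ℤ ((Fintype.card Q : ℚ) / e) := by
    rw [← isIntegral_algebraMap_iff (algebraMap ℚ ℂ).injective]
    simpa [hr] using hrint
  obtain ⟨m, hm⟩ := IsIntegrallyClosed.isIntegral_iff.1 hq
  have he0' : (e : ℚ) ≠ 0 := by exact_mod_cast hepos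
  rw [eq_div_iff he0'] at hm
  have hm' : m * (e : ℤ) = (Fintype.card Q : ℤ) := by
    have : ((m * (e : ℤ) : ℤ) : ℚ) = ((Fintype.card Q : ℤ) : ℚ) := by
      push_cast
      simpa using hm
    exact_mod_cast this
  rw [Nat.card_eq_fintype_card]
  exact Int.natCast_dvd_natCast.1 ⟨m, by rw [← hm', mul_comm]⟩

/-- An absolutely irreducible projective matrix representation of a finite group has degree
dividing the group order. -/
theorem Matrix.card_dvd_card_of_projective {Q : Type*} [Group Q] [Finite Q]
    {n : Type*} [Fintype n] [DecidableEq n] [Nonempty n] (B : Q → Matrix n n ℂ)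
    (hdet : ∀ a, (B a).det ≠ 0) (hB : ∀ a b, ∃ c : ℂ, B a * B b = c • B (a * b))
    (hcomm : ∀ T : Matrix n n ℂ, (∀ a, B a * T = T * B a) → ∃ c : ℂ, T = c • 1) :
    Fintype.card n ∣ Nat.card Q := by
  have hpos : 0 < Fintype.card n := Fintype.card_pos
  -- Rescaling by a root of the inverse determinant normalises the determinant to one.
  choose μ hμ using fun a => IsAlgClosed.exists_pow_nat_eq ((B a).det)⁻¹ hpos
  have hμ0 : ∀ a, μ a ≠ 0 := fun a h => by
    have := hμ a
    rw [h, zero_pow hpos.ne'] at this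
    exact inv_ne_zero (hdet a) this.symm
  refine Matrix.card_dvd_card_of_projective_of_det_eq_one (fun a => μ a • B a) ?_ ?_ ?_
  · intro a
    rw [Matrix.det_smul, hμ, inv_mul_cancel₀ (hdet a)]
  · intro a b
    obtain ⟨c, hc⟩ := hB a b
    refine ⟨μ a * μ b * c * (μ (a * b))⁻¹, ?_⟩
    rw [Matrix.smul_mul, Matrix.mul_smul, hc]
    simp only [smul_smul]
    rw [mul_assoc (μ a * μ b * c), inv_mul_cancel₀ (hμ0 _), mul_one, ← mul_assoc]
  · intro T hT
    refine hcomm T fun a => ?_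
    have := hT a
    rw [Matrix.smul_mul, Matrix.mul_smul] at this
    exact smul_right_injective _ (hμ0 a) this

namespace ProjectiveRep
namespace CocycleRep

variable {G : Type*} [Group G] {α : Z2 G} {V : Type*} [AddCommGroup V] [Module ℂ V]
  {W : Type*} [AddCommGroup W] [Module ℂ W] {N : Subgroup G}

/-! ### Clifford theory: translates and isotypic components -/

/-- A linear equivalence of submodules commuting with the group action, as an equivalence over the
operator algebra. -/
def algEquiv (φ : CocycleRep α V) {U U' : Submodule φ.OpAlg V} (e : U ≃ₗ[ℂ] U')
    (he : ∀ g (u : U), e (φ.gen g • u) = φ.gen g • e u) : U ≃ₗ[φ.OpAlg] U' :=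
  { e with
    map_smul' := fun r => by
      change ∀ u, e (r • u) = r • e u
      induction r using OpAlg.induction with
      | hgen g => exact he g
      | hscalar c => intro u; rw [algebraMap_smul, algebraMap_smul, map_smul]
      | hadd a b h1 h2 => intro u; rw [add_smul, add_smul, map_add, h1, h2]
      | hmul a b h1 h2 => intro u; rw [mul_smul, mul_smul, h1, h2] }

theorem isSimpleModule_toAlg {φ : CocycleRep α V} {U : Submodule ℂ V} (hU : φ.IsInv U)
    (h0 : U ≠ ⊥) (h : ∀ X, φ.IsInv X → X ≤ U → X = ⊥ ∨ X = U) :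
    IsSimpleModule φ.OpAlg hU.toAlg := by
  rw [isSimpleModule_iff_isAtom]
  constructor
  · intro h1
    apply h0
    rw [eq_bot_iff]
    intro v hv
    have : v ∈ hU.toAlg := hv
    rw [h1] at this
    exact this
  · intro X hX
    rcases h _ (φ.isInv_restrictScalars X) (fun v hv => hX.le hv) with h1 | h1
    · rw [eq_bot_iff]
      intro v hv
      have : v ∈ X.restrictScalars ℂ := hv
      rw [h1] at this
      exact this
    · exfalso
      refine hX.not_ge fun v hv => ?_
      have : v ∈ U := hv
      rw [← h1] at this
      exact this

/-- The scalar relating `φ(g) φ(n)` to `φ(g n g⁻¹) φ(g)`. -/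
noncomputable def conjScalar (α : Z2 G) (g n : G) : ℂ :=
  (((α : G → G → ℂˣ) g n * ((α : G → G → ℂˣ) (g * n * g⁻¹) g)⁻¹ : ℂˣ) : ℂ)

theorem apply_apply_conj (φ : CocycleRep α V) (g n : G) (v : V) :
    φ.toFun g (φ.toFun n v) = conjScalar α g n • φ.toFun (g * n * g⁻¹) (φ.toFun g v) := by
  rw [φ.map_mul, φ.map_mul, smul_smul, inv_mul_cancel_right, conjScalar, Units.val_mul, mul_assoc,
    ← Units.val_mul, inv_mul_cancel, Units.val_one, mul_one]

theorem conjScalar_ne_zero (α : Z2 G) (g n : G) : conjScalar α g n ≠ 0 := Units.ne_zero _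

theorem IsInv.map_res [hN : N.Normal] {ψ : CocycleRep α V} {U : Submodule ℂ V}
    (hU : (ψ.res N).IsInv U) (g : G) : (ψ.res N).IsInv (U.map (ψ.toFun g : V →ₗ[ℂ] V)) := by
  rintro n _ ⟨v, hv, rfl⟩
  change ψ.toFun n (ψ.toFun g v) ∈ _
  have h := ψ.apply_apply_conj g (g⁻¹ * n * g) v
  have e : g * (g⁻¹ * (n : G) * g) * g⁻¹ = n := by group
  rw [e, ← inv_smul_eq_iff₀ (conjScalar_ne_zero α _ _)] at h
  rw [← h]
  refine Submodule.smul_mem _ _ ⟨_, hU ⟨g⁻¹ * n * g, ?_⟩ v hv, rfl⟩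
  simpa using hN.conj_mem n n.2 g⁻¹

/-- The translate of a submodule of the restriction to a normal subgroup. -/
noncomputable def translate [N.Normal] (ψ : CocycleRep α V) (g : G)
    (U : Submodule (ψ.res N).OpAlg V) : Submodule (ψ.res N).OpAlg V :=
  (((ψ.res N).isInv_restrictScalars U).map_res g).toAlg

theorem mem_translate [N.Normal] {ψ : CocycleRep α V} {g : G} {U : Submodule (ψ.res N).OpAlg V}
    {v : V} : v ∈ ψ.translate g U ↔ ∃ u ∈ U, ψ.toFun g u = v := Iff.rfl

theorem apply_mem_translate [N.Normal] {ψ : CocycleRep α V} (g : G)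
    {U : Submodule (ψ.res N).OpAlg V} {v : V} (hv : v ∈ U) : ψ.toFun g v ∈ ψ.translate g U :=
  ⟨v, hv, rfl⟩

/-- The action of the group on the submodules of the restriction to a normal subgroup. -/
@[reducible]
noncomputable def translateAction [N.Normal] (ψ : CocycleRep α V) :
    MulAction G (Submodule (ψ.res N).OpAlg V) where
  smul := ψ.translate
  one_smul U := by
    ext v
    change v ∈ ψ.translate 1 U ↔ _
    rw [mem_translate]
    constructor
    -- The identity acts by the scalar `α(1, 1)`, which need not be `1` but preserves every
    -- subspace.
    · rintro ⟨u, hu, rfl⟩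
      rw [map_one_apply]
      exact (U.restrictScalars ℂ).smul_mem _ hu
    · intro hv
      refine ⟨(((α : G → G → ℂˣ) 1 1 : ℂˣ) : ℂ)⁻¹ • v, (U.restrictScalars ℂ).smul_mem _ hv, ?_⟩
      rw [map_smul, map_one_apply, smul_smul, inv_mul_cancel₀ (Units.ne_zero _), one_smul]
  mul_smul x y U := by
    ext v
    change v ∈ ψ.translate (x * y) U ↔ v ∈ ψ.translate x (ψ.translate y U)
    rw [mem_translate]
    constructor
    · rintro ⟨u, hu, rfl⟩
      rw [map_mul_symm]
      exact ((ψ.translate x (ψ.translate y U)).restrictScalars ℂ).smul_mem _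
        (apply_mem_translate x (apply_mem_translate y hu))
    · rintro ⟨_, ⟨u, hu, rfl⟩, rfl⟩
      refine ⟨(((α : G → G → ℂˣ) x y : ℂˣ) : ℂ) • u, (U.restrictScalars ℂ).smul_mem _ hu, ?_⟩
      rw [map_smul, ← ψ.map_mul]
      rfl

theorem translate_mono [N.Normal] (ψ : CocycleRep α V) (g : G)
    {U U' : Submodule (ψ.res N).OpAlg V} (h : U ≤ U') : ψ.translate g U ≤ ψ.translate g U' := by
  rintro _ ⟨u, hu, rfl⟩
  exact ⟨u, h hu, rfl⟩

/-- The group element acting as a linear equivalence onto the translate. -/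
noncomputable def translateEquiv [N.Normal] (ψ : CocycleRep α V) (g : G)
    (U : Submodule (ψ.res N).OpAlg V) : U ≃ₗ[ℂ] ψ.translate g U :=
  (ψ.toFun g).submoduleMap (U.restrictScalars ℂ)

theorem translateEquiv_gen_smul [hN : N.Normal] (ψ : CocycleRep α V) (g : G)
    (U : Submodule (ψ.res N).OpAlg V) (n : N) (u : U) :
    ψ.translateEquiv g U ((ψ.res N).gen n • u) = conjScalar α g n •
      (ψ.res N).gen ⟨g * n * g⁻¹, hN.conj_mem n n.2 g⟩ • ψ.translateEquiv g U u := by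
  apply Subtype.ext
  exact ψ.apply_apply_conj g n u

/-- The scalar and `n'` do not depend on `U`, so the twists on two translates match and isomorphisms
can be transported. -/
theorem exists_gen_smul_translateEquiv [hN : N.Normal] (ψ : CocycleRep α V) (g : G) (n : N) :
    ∃ (c : ℂ) (n' : N), ∀ (U : Submodule (ψ.res N).OpAlg V) (u : U),
      (ψ.res N).gen n • ψ.translateEquiv g U u
        = c • ψ.translateEquiv g U ((ψ.res N).gen n' • u) := by
  let n' : N := ⟨g⁻¹ * n * g, by simpa using hN.conj_mem n n.2 g⁻¹⟩
  have en : (⟨g * n' * g⁻¹, hN.conj_mem n' n'.2 g⟩ : N) = n := by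
    apply Subtype.ext; simp [n', mul_assoc]
  refine ⟨(conjScalar α g n')⁻¹, n', fun U u => ?_⟩
  rw [translateEquiv_gen_smul, en, smul_smul, inv_mul_cancel₀ (conjScalar_ne_zero _ _ _), one_smul]

set_option maxHeartbeats 1000000 in
theorem nonempty_translate_equiv [N.Normal] (ψ : CocycleRep α V) (g : G)
    {U U' : Submodule (ψ.res N).OpAlg V} (e : U ≃ₗ[(ψ.res N).OpAlg] U') :
    Nonempty (ψ.translate g U ≃ₗ[(ψ.res N).OpAlg] ψ.translate g U') := by
  obtain ⟨e', he⟩ : ∃ e' : U ≃ₗ[ℂ] U', ∀ (n : N) u,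
      e' ((ψ.res N).gen n • u) = (ψ.res N).gen n • e' u :=
    ⟨e.restrictScalars ℂ, fun n u => e.map_smul _ _⟩
  have hc := ψ.exists_gen_smul_translateEquiv (N := N) g
  generalize ψ.translateEquiv (N := N) g = T at hc
  refine ⟨(ψ.res N).algEquiv ((T U).symm.trans (e'.trans (T U'))) fun n u => ?_⟩
  obtain ⟨u, rfl⟩ := (T U).surjective u
  obtain ⟨c, n', h⟩ := hc n
  simp only [LinearEquiv.trans_apply, LinearEquiv.symm_apply_apply]
  rw [h U u, h U' (e' u), LinearEquiv.map_smul, LinearEquiv.map_smul, LinearEquiv.map_smul,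
    LinearEquiv.symm_apply_apply, he]

theorem isSimpleModule_translate [N.Normal] (ψ : CocycleRep α V) (g : G)
    (S : Submodule (ψ.res N).OpAlg V) [hS : IsSimpleModule (ψ.res N).OpAlg S] :
    IsSimpleModule (ψ.res N).OpAlg (ψ.translate g S) := by
  let := ψ.translateAction (N := N)
  rw [isSimpleModule_iff_isAtom] at hS ⊢
  let o : Submodule (ψ.res N).OpAlg V ≃o Submodule (ψ.res N).OpAlg V :=
    { MulAction.toPerm g with
      map_rel_iff' := by
        intro a b
        constructor
        · intro h
          have := ψ.translate_mono g⁻¹ h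
          change g⁻¹ • g • a ≤ g⁻¹ • g • b at this
          rwa [inv_smul_smul, inv_smul_smul] at this
        · exact ψ.translate_mono g }
  exact (OrderIso.isAtom_iff o S).2 hS

theorem translate_isotypicComponent_le [N.Normal] (ψ : CocycleRep α V) (g : G)
    (S : Submodule (ψ.res N).OpAlg V) :
    ψ.translate g (isotypicComponent (ψ.res N).OpAlg V S)
      ≤ isotypicComponent (ψ.res N).OpAlg V (ψ.translate g S) := by
  let := ψ.translateAction (N := N)
  have h : isotypicComponent (ψ.res N).OpAlg V S
      ≤ ψ.translate g⁻¹ (isotypicComponent (ψ.res N).OpAlg V (ψ.translate g S)) := by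
    refine sSup_le fun m hm => ?_
    obtain ⟨e⟩ := hm
    obtain ⟨e'⟩ := ψ.nonempty_translate_equiv g e
    have h1 : ψ.translate g m ≤ isotypicComponent (ψ.res N).OpAlg V (ψ.translate g S) :=
      le_sSup ⟨e'⟩
    have h2 := ψ.translate_mono g⁻¹ h1
    change g⁻¹ • g • m ≤ _ at h2
    rwa [inv_smul_smul] at h2
  have h2 := ψ.translate_mono g h
  change _ ≤ g • g⁻¹ • isotypicComponent (ψ.res N).OpAlg V (ψ.translate g S) at h2
  rwa [smul_inv_smul] at h2

theorem translate_isotypicComponent [N.Normal] (ψ : CocycleRep α V) (g : G)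
    (S : Submodule (ψ.res N).OpAlg V) :
    ψ.translate g (isotypicComponent (ψ.res N).OpAlg V S)
      = isotypicComponent (ψ.res N).OpAlg V (ψ.translate g S) := by
  let := ψ.translateAction (N := N)
  refine le_antisymm (ψ.translate_isotypicComponent_le g S) ?_
  have h := ψ.translate_mono g (ψ.translate_isotypicComponent_le g⁻¹ (ψ.translate g S))
  change g • g⁻¹ • isotypicComponent (ψ.res N).OpAlg V (ψ.translate g S)
    ≤ ψ.translate g (isotypicComponent (ψ.res N).OpAlg V (g⁻¹ • g • S : Submodule _ V)) at h
  rwa [smul_inv_smul, inv_smul_smul] at h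

/-- The translates of one component span a nonzero invariant subspace, hence everything;
independence of the components leaves room for no other. -/
theorem isotypicComponents_eq_orbit [Finite G] [N.Normal] {ψ : CocycleRep α V}
    (hψ : ψ.IsIrreducible) (S : Submodule (ψ.res N).OpAlg V) [IsSimpleModule (ψ.res N).OpAlg S] :
    isotypicComponents (ψ.res N).OpAlg V = Set.range fun g : G =>
      ψ.translate g (isotypicComponent (ψ.res N).OpAlg V S) := by
  let := ψ.translateAction (N := N)
  set T := isotypicComponent (ψ.res N).OpAlg V S with hT
  have hsub : ∀ g, ψ.translate g T ∈ isotypicComponents (ψ.res N).OpAlg V := fun g =>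
    ⟨ψ.translate g S, ψ.isSimpleModule_translate g S, ψ.translate_isotypicComponent g S⟩
  have htop : ⨆ g, ψ.translate g T = ⊤ := by
    have hinv : ψ.IsInv ((⨆ g, ψ.translate g T).restrictScalars ℂ) := by
      intro g v hv
      have h1 : (⨆ g, ψ.translate g T) ≤ ψ.translate g⁻¹ (⨆ g, ψ.translate g T) := by
        refine iSup_le fun x => ?_
        have h2 := ψ.translate_mono g⁻¹ (le_iSup (fun g => ψ.translate g T) (g * x))
        change g⁻¹ • (g * x) • T ≤ _ at h2
        rwa [← mul_smul, inv_mul_cancel_left] at h2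
      have h3 := ψ.translate_mono g h1
      change _ ≤ g • g⁻¹ • (⨆ g, ψ.translate g T) at h3
      rw [smul_inv_smul] at h3
      exact h3 (apply_mem_translate g hv)
    rcases hψ.2 _ hinv with h | h
    · exfalso
      have h1 : (1 : G) • T ≤ ⨆ g, ψ.translate g T := le_iSup (fun g => ψ.translate g T) 1
      rw [one_smul] at h1
      have h2 := (bot_lt_isotypicComponent (R := (ψ.res N).OpAlg) S).trans_le h1
      refine h2.ne' (eq_bot_iff.2 fun v hv => ?_)
      have : v ∈ (⨆ g, ψ.translate g T).restrictScalars ℂ := hv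
      rw [h] at this
      exact this
    · rw [eq_top_iff]
      intro v _
      have : v ∈ (⨆ g, ψ.translate g T).restrictScalars ℂ := h ▸ Submodule.mem_top
      exact this
  apply Set.Subset.antisymm
  · intro c hc
    by_contra hcon
    have hdis := sSupIndep_isotypicComponents (ψ.res N).OpAlg V hc
    have h1 : (⊤ : Submodule (ψ.res N).OpAlg V)
        ≤ sSup (isotypicComponents (ψ.res N).OpAlg V \ {c}) := by
      rw [← htop]
      refine iSup_le fun g => le_sSup ⟨hsub g, fun h => hcon ⟨g, h⟩⟩
    rw [top_le_iff.1 h1, disjoint_top] at hdis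
    exact (bot_lt_isotypicComponents hc).ne' hdis
  · rintro _ ⟨g, rfl⟩
    exact hsub g

/-- If the degree of an irreducible module is coprime to the index of a normal subgroup, then its
restriction to the normal subgroup is isotypic. -/
theorem IsIrreducible.isIsotypicOfType_of_coprime [Finite G] [N.Normal] [FiniteDimensional ℂ V]
    {ψ : CocycleRep α V} (hψ : ψ.IsIrreducible)
    (hcop : (Module.finrank ℂ V).Coprime (Nat.card (G ⧸ N)))
    (S : Submodule (ψ.res N).OpAlg V) [IsSimpleModule (ψ.res N).OpAlg S] :
    IsIsotypicOfType (ψ.res N).OpAlg V S := by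
  classical
  let := ψ.translateAction (N := N)
  have := (ψ.res N).isSemisimpleModule_opAlg
  have : Module.Finite (ψ.res N).OpAlg V := Module.Finite.of_restrictScalars_finite ℂ _ V
  set T := isotypicComponent (ψ.res N).OpAlg V S with hT
  set I := isotypicComponents (ψ.res N).OpAlg V with hI
  have hIT : I = MulAction.orbit G T := isotypicComponents_eq_orbit hψ S
  have hfin : Finite I := by
    rw [hIT]
    exact (Set.finite_range _).to_subtype
  have := Fintype.ofFinite I
  -- The stabiliser of `T` contains `N`, so the orbit length divides the index.
  have hindex : I.ncard ∣ Nat.card (G ⧸ N) := by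
    rw [hIT, ← MulAction.index_stabilizer, ← Subgroup.index_eq_card]
    refine Subgroup.index_dvd_of_le fun n hn => ?_
    rw [MulAction.mem_stabilizer_iff]
    have hle : ∀ n ∈ N, n • T ≤ T := by
      rintro n hn _ ⟨v, hv, rfl⟩
      exact T.smul_mem ((ψ.res N).gen ⟨n, hn⟩) hv
    refine le_antisymm (hle n hn) ?_
    have := ψ.translate_mono n (hle n⁻¹ (N.inv_mem hn))
    change n • n⁻¹ • T ≤ n • T at this
    rwa [smul_inv_smul] at this
  -- `V` is the direct sum of the components, which are translates of `T` and so have equal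
  -- dimension.
  have hdim : I.ncard ∣ Module.finrank ℂ V := by
    have hint : DirectSum.IsInternal (fun c : I => (c : Submodule (ψ.res N).OpAlg V)) := by
      apply DirectSum.isInternal_submodule_of_iSupIndep_of_iSup_eq_top
      · exact ((sSupIndep_iff _).1 (sSupIndep_isotypicComponents (ψ.res N).OpAlg V))
      · rw [← sSup_eq_iSup']
        exact sSup_isotypicComponents _ _
    have e := (LinearEquiv.ofBijective (DirectSum.coeLinearMap
      (fun c : I => (c : Submodule (ψ.res N).OpAlg V))) hint).restrictScalars ℂ
    have hfd : ∀ c : I, FiniteDimensional ℂ (c : Submodule (ψ.res N).OpAlg V) := fun c =>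
      inferInstanceAs (FiniteDimensional ℂ ((c : Submodule (ψ.res N).OpAlg V).restrictScalars ℂ))
    have hrank : ∀ c : I, Module.finrank ℂ (c : Submodule (ψ.res N).OpAlg V)
        = Module.finrank ℂ T := by
      rintro ⟨c, hc⟩
      rw [hIT] at hc
      obtain ⟨g, rfl⟩ := hc
      exact (ψ.translateEquiv g T).finrank_eq.symm
    rw [← e.finrank_eq, Module.finrank_directSum]
    simp only [hrank, Finset.sum_const, Finset.card_univ, smul_eq_mul]
    rw [← Nat.card_coe_set_eq, Nat.card_eq_fintype_card]
    exact dvd_mul_right _ _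
  have hone : I.ncard = 1 := Nat.eq_one_of_dvd_coprimes hcop hdim hindex
  obtain ⟨c, hc⟩ := Set.ncard_eq_one.1 hone
  have hTI : T ∈ I := ⟨S, inferInstance, rfl⟩
  have hTtop : T = ⊤ := by
    rw [← sSup_isotypicComponents (ψ.res N).OpAlg V, ← hI, hc, sSup_singleton]
    rw [hc] at hTI
    exact hTI
  exact IsIsotypicOfType.of_isotypicComponent_eq_top hTtop

end CocycleRep
end ProjectiveRep

/-! ### Tensor decomposition and irreducible restriction -/

namespace ProjectiveRep
namespace CocycleRep

variable {G : Type*} [Group G] {α : Z2 G} {V : Type*} [AddCommGroup V] [Module ℂ V]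
  {W : Type*} [AddCommGroup W] [Module ℂ W] {N : Subgroup G}

theorem exists_equiv_of_isHom {φ : CocycleRep α V} (hφ : φ.IsIrreducible) {ψ : CocycleRep α W}
    {f : V →ₗ[ℂ] W} (hf : φ.IsHom ψ f) (hfi : Function.Injective f) :
    ∃ S : Submodule ψ.OpAlg W, IsSimpleModule ψ.OpAlg S ∧
      ∃ fS : V ≃ₗ[ℂ] S, ∀ g v, fS (φ.toFun g v) = ψ.gen g • fS v := by
  refine ⟨hf.isInv_range.toAlg, isSimpleModule_toAlg _ ?_ ?_, LinearEquiv.ofInjective f hfi, ?_⟩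
  · intro h
    have := hφ.1
    obtain ⟨v, hv⟩ := exists_ne (0 : V)
    have h1 : f v ∈ LinearMap.range f := ⟨v, rfl⟩
    rw [h, Submodule.mem_bot] at h1
    exact hv (hfi (h1.trans (map_zero f).symm))
  · intro X hX hle
    have hinv : φ.IsInv (X.comap f) := by
      intro g v hv
      rw [Submodule.mem_comap, hf]
      exact hX g _ hv
    rcases hφ.2 _ hinv with h | h
    · left
      rw [eq_bot_iff]
      intro x hx
      obtain ⟨v, rfl⟩ := hle hx
      have h1 : v ∈ X.comap f := hx
      rw [h, Submodule.mem_bot] at h1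
      rw [h1, map_zero]
      exact Submodule.zero_mem _
    · right
      refine le_antisymm hle ?_
      rintro _ ⟨v, rfl⟩
      have h1 : v ∈ X.comap f := h ▸ Submodule.mem_top
      exact h1
  · intro g v
    apply Subtype.ext
    exact hf g v

theorem exists_equiv_pi_of_isIsotypicOfType [FiniteDimensional ℂ W] [Finite G]
    {φ : CocycleRep α V} {ψ : CocycleRep α W}
    {S : Submodule ψ.OpAlg W} (fS : V ≃ₗ[ℂ] S) (hfS : ∀ g v, fS (φ.toFun g v) = ψ.gen g • fS v)
    (h : IsIsotypicOfType ψ.OpAlg W S) :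
    ∃ (e : ℕ) (E : W ≃ₗ[ℂ] (Fin e → V)), ∀ g w i, E (ψ.toFun g w) i = φ.toFun g (E w i) := by
  have := ψ.isSemisimpleModule_opAlg
  have : Module.Finite ψ.OpAlg W := Module.Finite.of_restrictScalars_finite ℂ _ W
  obtain ⟨e, ⟨E⟩⟩ := h.linearEquiv_fun
  refine ⟨e, (E.restrictScalars ℂ).trans (LinearEquiv.piCongrRight fun _ => fS.symm), ?_⟩
  intro g w i
  change fS.symm (E (ψ.gen g • w) i) = φ.toFun g (fS.symm (E w i))
  rw [LinearEquiv.symm_apply_eq, hfS, LinearEquiv.apply_symm_apply, E.map_smul, Pi.smul_apply]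

-- The translate of `S` by `g` is simple, so isotypicity identifies it with `S`. Acting by `g` and
-- then identifying gives `A`: `φ` is isomorphic to its conjugate by `g`.
set_option maxHeartbeats 1000000 in
theorem exists_conj_of_isIsotypicOfType [hN : N.Normal]
    {φ : CocycleRep (resZ2 N α) V} {ψ : CocycleRep α W}
    {S : Submodule (ψ.res N).OpAlg W} [IsSimpleModule (ψ.res N).OpAlg S]
    (fS : V ≃ₗ[ℂ] S) (hfS : ∀ g v, fS (φ.toFun g v) = (ψ.res N).gen g • fS v)
    (h : IsIsotypicOfType (ψ.res N).OpAlg W S) (g : G) :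
    ∃ A : V ≃ₗ[ℂ] V, ∀ (n : N) v,
      A (φ.toFun n v) = conjScalar α g n • φ.toFun ⟨g * n * g⁻¹, hN.conj_mem n n.2 g⟩ (A v) := by
  have := ψ.isSimpleModule_translate g S
  obtain ⟨u⟩ := h (ψ.translate g S)
  obtain ⟨u', hu'⟩ : ∃ u' : ψ.translate g S ≃ₗ[ℂ] S, ∀ (n : N) x,
      u' ((ψ.res N).gen n • x) = (ψ.res N).gen n • u' x :=
    ⟨u.restrictScalars ℂ, fun n x => u.map_smul _ _⟩
  refine ⟨fS.trans ((ψ.translateEquiv g S).trans (u'.trans fS.symm)), fun n v => ?_⟩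
  have h1 := ψ.translateEquiv_gen_smul g S n (fS v)
  generalize ψ.translateEquiv g S = T at h1
  simp only [LinearEquiv.trans_apply]
  rw [hfS, h1, LinearEquiv.map_smul, LinearEquiv.map_smul, hu']
  congr 1
  rw [LinearEquiv.symm_apply_eq, hfS, LinearEquiv.apply_symm_apply]

/-- A module whose operators are of the form `b(g) ⊗ A(g)`, with a normal subgroup acting trivially
on the first factor, has first factor of degree dividing the index. -/
theorem IsIrreducible.dvd_card_quotient_of_tensor [Finite G] [N.Normal] [FiniteDimensional ℂ W]
    [Nontrivial V] {ψ : CocycleRep α W} (hψ : ψ.IsIrreducible) {e : ℕ}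
    (E : W ≃ₗ[ℂ] (Fin e → V)) (R : N → V ≃ₗ[ℂ] V)
    (hR : ∀ (n : N) w i, E (ψ.toFun n w) i = R n (E w i))
    (A : G → V ≃ₗ[ℂ] V) (b : G → Matrix (Fin e) (Fin e) ℂ)
    (hb : ∀ g w i, E (ψ.toFun g w) i = ∑ j, b g i j • A g (E w j)) :
    e ∣ Nat.card (G ⧸ N) := by
  classical
  obtain ⟨s, hs⟩ := exists_ne (0 : V)
  have := hψ.1
  have hne : Nonempty (Fin e) := by
    by_contra hcon
    rw [not_nonempty_iff] at hcon
    exact not_subsingleton W E.toEquiv.subsingleton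
  have hsingle : ∀ g i j (v : V),
      E (ψ.toFun g (E.symm (Pi.single j v))) i = b g i j • A g v := by
    intro g i j v
    rw [hb, LinearEquiv.apply_symm_apply, Finset.sum_eq_single j]
    · rw [Pi.single_eq_same]
    · intro k _ hk
      rw [Pi.single_eq_of_ne hk, map_zero, smul_zero]
    · simp
  have hcard : e = Fintype.card (Fin e) := (Fintype.card_fin e).symm
  rw [hcard]
  refine Matrix.card_dvd_card_of_projective (fun q : G ⧸ N => b q.out) ?_ ?_ ?_
  -- A kernel vector `w` of `b` would make `w ⊗ s` a nonzero vector killed by an invertible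
  -- operator.
  · intro q hdet
    obtain ⟨w, hw, hw0⟩ := Matrix.exists_mulVec_eq_zero_iff.2 hdet
    have h0 : ψ.toFun q.out (E.symm fun j => w j • s) = 0 := by
      apply E.injective
      ext i
      rw [hb, map_zero, LinearEquiv.apply_symm_apply]
      have h1 := congrFun hw0 i
      simp only [Matrix.mulVec, dotProduct, Pi.zero_apply] at h1
      simp only [map_smul, smul_smul, ← Finset.sum_smul, h1, zero_smul, Pi.zero_apply]
    rw [LinearEquiv.map_eq_zero_iff, LinearEquiv.map_eq_zero_iff] at h0
    apply hw
    ext j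
    have := congrFun h0 j
    simpa [hs] using this
  · intro p q
    obtain ⟨n, hn⟩ : ∃ n : N, p.out * q.out = (p * q).out * (n : G) := by
      have h1 : ((p * q).out : G ⧸ N) = ((p.out * q.out : G) : G ⧸ N) := by
        rw [QuotientGroup.mk_mul]
        simp
      rw [QuotientGroup.eq] at h1
      exact ⟨⟨_, h1⟩, by simp⟩
    set x := A p.out (A q.out s) with hx
    have hx0 : x ≠ 0 := by simpa [hx] using hs
    set y := A (p * q).out (R n s) with hy
    have hy0 : y ≠ 0 := by simpa [hy] using hs
    obtain ⟨c, hc0, hc⟩ : ∃ c : ℂ, c ≠ 0 ∧ ∀ w, ψ.toFun p.out (ψ.toFun q.out w)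
        = c • ψ.toFun (p * q).out (ψ.toFun n w) := by
      refine ⟨(((α : G → G → ℂˣ) p.out q.out : ℂˣ) : ℂ)
        * (((α : G → G → ℂˣ) (p * q).out n : ℂˣ) : ℂ)⁻¹,
        mul_ne_zero (Units.ne_zero _) (inv_ne_zero (Units.ne_zero _)), fun w => ?_⟩
      rw [ψ.map_mul, hn, map_mul_symm, smul_smul]
    -- Comparing entries on `s`: one nonzero entry makes `x` and `y` proportional, with a ratio
    -- independent of the entry.
    have key : ∀ i j, (b p.out * b q.out) i j • x = (c * b (p * q).out i j) • y := by
      intro i j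
      have h1 := congrFun (congrArg E (hc (E.symm (Pi.single j s)))) i
      have h2 : ψ.toFun (n : G) (E.symm (Pi.single j s)) = E.symm (Pi.single j (R n s)) := by
        apply E.injective
        ext k
        rw [hR, LinearEquiv.apply_symm_apply, LinearEquiv.apply_symm_apply]
        by_cases hk : k = j
        · subst hk; simp
        · simp [hk]
      rw [h2, map_smul, Pi.smul_apply, hsingle, hb] at h1
      simp only [hsingle] at h1
      rw [mul_smul, hy, ← h1, Matrix.mul_apply, Finset.sum_smul]
      exact Finset.sum_congr rfl fun k _ => by rw [map_smul, smul_smul]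
    by_cases hP : ∃ i j, (b p.out * b q.out) i j ≠ 0
    · obtain ⟨i, j, hij⟩ := hP
      set r := ((b p.out * b q.out) i j)⁻¹ * (c * b (p * q).out i j) with hr
      have hxy : x = r • y := by
        rw [hr, mul_smul, ← key, smul_smul, inv_mul_cancel₀ hij, one_smul]
      have hr0 : r ≠ 0 := fun h0 => hx0 (by rw [hxy, h0, zero_smul])
      refine ⟨r⁻¹ * c, ?_⟩
      ext k l
      have h1 := key k l
      rw [hxy, smul_smul] at h1
      have h2 := smul_left_injective ℂ hy0 h1
      rw [Matrix.smul_apply, smul_eq_mul, mul_assoc, ← h2]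
      field_simp
    · push Not at hP
      refine ⟨0, ?_⟩
      ext i j
      rw [hP]
      simp
  · intro T hT
    -- `T ⊗ 1` commutes with coset representatives by assumption and with `N`, which acts only on
    -- the factor `V`; Schur's lemma makes it scalar.
    let L : W →ₗ[ℂ] W := (E.symm : (Fin e → V) →ₗ[ℂ] W) ∘ₗ
      (LinearMap.pi fun i => ∑ j, T i j • LinearMap.proj j) ∘ₗ (E : W →ₗ[ℂ] (Fin e → V))
    have hL : ∀ w i, E (L w) i = ∑ j, T i j • E w j := by
      intro w i
      simp [L]
    have hLout : ∀ (q : G ⧸ N) w, L (ψ.toFun q.out w) = ψ.toFun q.out (L w) := by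
      intro q w
      apply E.injective
      ext i
      rw [hL, hb]
      simp only [hL, hb]
      have h1 : ∀ k, ∑ j, T i j * b q.out j k = ∑ j, b q.out i j * T j k := fun k => by
        have := congrFun (congrFun (hT q) i) k
        rw [Matrix.mul_apply, Matrix.mul_apply] at this
        exact this.symm
      simp only [map_sum, map_smul, Finset.smul_sum, smul_smul]
      rw [Finset.sum_comm, Finset.sum_comm (γ := Fin e) (s := Finset.univ) (t := Finset.univ)
        (f := fun j k => (b q.out i j * T j k) • A q.out (E w k))]
      simp only [← Finset.sum_smul, h1]
    have hLN : ∀ (n : N) w, L (ψ.toFun n w) = ψ.toFun n (L w) := by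
      intro n w
      apply E.injective
      ext i
      rw [hL, hR, hL]
      simp only [hR, map_sum, map_smul]
    have hLhom : ψ.IsHom ψ L := by
      intro g w
      obtain ⟨q, n, rfl⟩ : ∃ (q : G ⧸ N) (n : N), g = q.out * n := by
        have h1 : ((g : G ⧸ N).out : G ⧸ N) = (g : G ⧸ N) := by simp
        rw [QuotientGroup.eq] at h1
        exact ⟨g, ⟨_, h1⟩, by simp⟩
      rw [map_mul_symm, map_mul_symm, map_smul, hLout, hLN]
    obtain ⟨c, hc⟩ := hψ.exists_smul hLhom
    refine ⟨c, ?_⟩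
    ext i j
    have h1 := hL (E.symm (Pi.single j s)) i
    rw [hc, map_smul, LinearEquiv.apply_symm_apply, Finset.sum_eq_single j] at h1
    · by_cases hij : i = j
      · subst hij
        simp only [Pi.smul_apply, Pi.single_eq_same] at h1
        rw [← smul_left_injective ℂ hs h1]
        simp
      · simp only [Pi.smul_apply, Pi.single_eq_same, Pi.single_eq_of_ne hij, smul_zero] at h1
        have := (smul_eq_zero.1 h1.symm).resolve_right hs
        simp [this, hij]
    · intro k _ hk
      rw [Pi.single_eq_of_ne hk, smul_zero]
    · simp

/-- An irreducible module of degree coprime to the index of a normal subgroup restricts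
irreducibly to the normal subgroup. -/
theorem IsIrreducible.finrank_eq_of_coprime [Finite G] [hN : N.Normal] [FiniteDimensional ℂ V]
    [FiniteDimensional ℂ W] {φ : CocycleRep (resZ2 N α) V} (hφ : φ.IsIrreducible)
    {ψ : CocycleRep α W} (hψ : ψ.IsIrreducible) (hlies : ψ.LiesOver φ)
    (hcop : (Module.finrank ℂ W).Coprime (Nat.card (G ⧸ N))) :
    Module.finrank ℂ W = Module.finrank ℂ V := by
  classical
  obtain ⟨f, hfi, hf⟩ := hlies
  have := hφ.1
  obtain ⟨S, hS, fS, hfS⟩ := exists_equiv_of_isHom hφ (ψ := ψ.res N) hf hfi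
  have hiso := hψ.isIsotypicOfType_of_coprime hcop S
  obtain ⟨e, E, hE⟩ := exists_equiv_pi_of_isIsotypicOfType fS hfS hiso
  choose A hA using exists_conj_of_isIsotypicOfType fS hfS hiso
  -- Each block of `ψ(g)` twists the action of `N` exactly as `A(g)` does, so `A(g)⁻¹` times the
  -- block is scalar by Schur's lemma.
  have hb : ∀ g i j, ∃ c : ℂ, ∀ v,
      E (ψ.toFun g (E.symm (Pi.single j v))) i = c • A g v := by
    intro g i j
    let T : V →ₗ[ℂ] V := ((A g).symm : V →ₗ[ℂ] V) ∘ₗ LinearMap.proj i ∘ₗ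
      (E : W →ₗ[ℂ] (Fin e → V)) ∘ₗ (ψ.toFun g : W →ₗ[ℂ] W) ∘ₗ
      (E.symm : (Fin e → V) →ₗ[ℂ] W) ∘ₗ LinearMap.single ℂ (fun _ => V) j
    have hT : φ.IsHom φ T := by
      intro n v
      change (A g).symm (E (ψ.toFun g (E.symm (Pi.single j (φ.toFun n v)))) i)
        = φ.toFun n ((A g).symm (E (ψ.toFun g (E.symm (Pi.single j v))) i))
      have h1 : E.symm (Pi.single j (φ.toFun n v)) = ψ.toFun n (E.symm (Pi.single j v)) := by
        apply E.injective
        ext k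
        have h2 := hE n (E.symm (Pi.single j v)) k
        refine Eq.trans ?_ h2.symm
        rw [LinearEquiv.apply_symm_apply, LinearEquiv.apply_symm_apply]
        by_cases hk : k = j
        · subst hk; simp
        · simp [hk]
      rw [LinearEquiv.symm_apply_eq, hA, LinearEquiv.apply_symm_apply, h1, apply_apply_conj,
        map_smul, Pi.smul_apply]
      congr 1
      exact hE ⟨g * n * g⁻¹, hN.conj_mem n n.2 g⟩ _ i
    obtain ⟨c, hc⟩ := hφ.exists_smul hT
    refine ⟨c, fun v => ?_⟩
    have h1 : (A g).symm (E (ψ.toFun g (E.symm (Pi.single j v))) i) = c • v := hc v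
    rw [LinearEquiv.symm_apply_eq, map_smul] at h1
    exact h1
  choose b hb using hb
  have hdvd : e ∣ Nat.card (G ⧸ N) := by
    refine hψ.dvd_card_quotient_of_tensor E φ.toFun (fun n => hE n) A (fun g => Matrix.of (b g)) ?_
    intro g w i
    have h1 : w = ∑ j, E.symm (Pi.single j (E w j)) := by
      rw [← map_sum, Finset.univ_sum_single, LinearEquiv.symm_apply_apply]
    conv_lhs => rw [h1]
    simp only [map_sum, Finset.sum_apply, hb, Matrix.of_apply]
  have hrank : Module.finrank ℂ W = e * Module.finrank ℂ V := by
    rw [E.finrank_eq, Module.finrank_pi_fintype]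
    simp
  have he : e = 1 := Nat.eq_one_of_dvd_coprimes hcop (hrank ▸ dvd_mul_right _ _) hdvd
  rw [hrank, he, one_mul]

end CocycleRep
end ProjectiveRep

/-! ### Extending `V` and commutativity of the quotient -/

namespace ProjectiveRep
namespace CocycleRep

variable {G : Type*} [Group G] {α : Z2 G} {V : Type*} [AddCommGroup V] [Module ℂ V]
  {W : Type*} [AddCommGroup W] [Module ℂ W] {N : Subgroup G}

theorem IsIrreducible.of_bijective {φ : CocycleRep α V} (hφ : φ.IsIrreducible)
    {ψ : CocycleRep α W} {f : V →ₗ[ℂ] W} (hf : φ.IsHom ψ f) (hbij : Function.Bijective f) :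
    ψ.IsIrreducible := by
  have := hφ.1
  refine ⟨hbij.1.nontrivial, fun U hU => ?_⟩
  have hinv : φ.IsInv (U.comap f) := by
    intro g v hv
    rw [Submodule.mem_comap, hf]
    exact hU g _ hv
  have hmap : (U.comap f).map f = U := Submodule.map_comap_eq_of_surjective hbij.2 U
  rcases hφ.2 _ hinv with h | h
  · left
    rw [← hmap, h, Submodule.map_bot]
  · right
    rw [← hmap, h, Submodule.map_top, LinearMap.range_eq_top]
    exact hbij.2

/-- The tensor product of a projective representation with the regular representation of the
quotient by a normal subgroup, realised on functions. -/
def tensorRegular [N.Normal] (ρ : CocycleRep α V) : CocycleRep α (G ⧸ N → V) where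
  toFun g :=
    { toFun := fun F q => ρ.toFun g (F ((g : G ⧸ N)⁻¹ * q))
      invFun := fun F q => (ρ.toFun g).symm (F ((g : G ⧸ N) * q))
      map_add' := by intro F F'; ext q; simp
      map_smul' := by intro c F; ext q; simp
      left_inv := by intro F; ext q; simp
      right_inv := by intro F; ext q; simp }
  map_mul x y F := by
    ext q
    simp [ρ.map_mul, mul_assoc]

theorem tensorRegular_single [N.Normal] [DecidableEq (G ⧸ N)] (ρ : CocycleRep α V) (g : G)
    (q : G ⧸ N) (v : V) : (ρ.tensorRegular (N := N)).toFun g (Pi.single q v)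
      = Pi.single ((g : G ⧸ N) * q) (ρ.toFun g v) := by
  ext r
  change ρ.toFun g ((Pi.single q v : G ⧸ N → V) ((g : G ⧸ N)⁻¹ * r)) = _
  by_cases h : r = (g : G ⧸ N) * q
  · subst h
    simp
  · have h' : (g : G ⧸ N)⁻¹ * r ≠ q := fun h1 => h (by rw [← h1, mul_inv_cancel_left])
    rw [Pi.single_eq_of_ne h, Pi.single_eq_of_ne h', map_zero]

/-- If every irreducible module over an irreducible module `φ` of a normal subgroup has degree
coprime to the index, then the quotient group is abelian. -/
theorem IsIrreducible.quotient_comm_of_coprime [Finite G] [N.Normal] [FiniteDimensional ℂ V]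
    {φ : CocycleRep (resZ2 N α) V} (hφ : φ.IsIrreducible)
    (h : ∀ (n : ℕ) (ψ : CocycleRep α (Fin n → ℂ)), ψ.IsIrreducible → ψ.LiesOver φ →
      (Module.finrank ℂ (Fin n → ℂ)).Coprime (Nat.card (G ⧸ N))) (a b : G ⧸ N) :
    a * b = b * a := by
  classical
  have hdim : ∀ (n : ℕ) (ψ : CocycleRep α (Fin n → ℂ)), ψ.IsIrreducible → ψ.LiesOver φ →
      Module.finrank ℂ (Fin n → ℂ) = Module.finrank ℂ V := fun n ψ hψ hl =>
    hφ.finrank_eq_of_coprime hψ hl (h n ψ hψ hl)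
  obtain ⟨n, ρ, hρ, hl⟩ := exists_irreducible_liesOver hφ
  have hnV := hdim n ρ hρ hl
  obtain ⟨f, hfi, hf⟩ := hl
  -- Equality of degrees turns the embedding of `φ` into an isomorphism: `ρ` extends `φ`.
  have hρN : (ρ.res N).IsIrreducible := hφ.of_bijective hf
    ⟨hfi, (LinearMap.injective_iff_surjective_of_finrank_eq_finrank hnV.symm).1 hfi⟩
  by_contra hab
  have := hρ.1
  obtain ⟨z, hz⟩ := exists_ne (0 : Fin n → ℂ)
  have hy : (Pi.single (a * b) z - Pi.single (b * a) z : G ⧸ N → Fin n → ℂ) ≠ 0 := by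
    intro h0
    have h1 := congrFun h0 (a * b)
    rw [Pi.sub_apply, Pi.single_eq_same, Pi.single_eq_of_ne hab, sub_zero] at h1
    exact hz h1
  obtain ⟨m, ψ, p, hψ, hp, hpy⟩ := (ρ.tensorRegular (N := N)).exists_irreducible_quotient hy
  let P : G ⧸ N → (Fin n → ℂ) →ₗ[ℂ] (Fin m → ℂ) := fun q =>
    p ∘ₗ LinearMap.single ℂ (fun _ : G ⧸ N => Fin n → ℂ) q
  have hPapp : ∀ q v, P q v = p (Pi.single q v) := fun q v => rfl
  have hPg : ∀ (g : G) q v, P ((g : G ⧸ N) * q) (ρ.toFun g v) = ψ.toFun g (P q v) := by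
    intro g q v
    rw [hPapp, hPapp, ← hp, tensorRegular_single]
  have hPN : ∀ q, (ρ.res N).IsHom (ψ.res N) (P q) := by
    intro q k v
    have h1 := hPg k q v
    rwa [(QuotientGroup.eq_one_iff (k : G)).2 k.2, one_mul] at h1
  obtain ⟨q₀, hq₀⟩ : ∃ q, P q ≠ 0 := by
    by_contra! hcon
    apply hpy
    rw [map_sub, ← hPapp, ← hPapp, hcon, hcon]
    simp
  have hinj := hρN.injective (hPN q₀) hq₀
  have hmn : Module.finrank ℂ (Fin n → ℂ) = Module.finrank ℂ (Fin m → ℂ) := by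
    rw [hnV, hdim m ψ hψ ⟨P q₀ ∘ₗ f, hinj.comp hfi, fun k v => ?_⟩]
    rw [LinearMap.comp_apply, hf]
    exact hPN q₀ k _
  have hbij : Function.Bijective (P q₀) :=
    ⟨hinj, (LinearMap.injective_iff_surjective_of_finrank_eq_finrank hmn).1 hinj⟩
  let e := LinearEquiv.ofBijective (P q₀) hbij
  have he : ∀ v, e v = P q₀ v := fun v => rfl
  -- `P q₀` is an isomorphism over `N`, so Schur's lemma applies to `(P q₀)⁻¹ P q`.
  have hc : ∀ q, ∃ c : ℂ, ∀ v, P q v = c • P q₀ v := by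
    intro q
    obtain ⟨c, hc⟩ := hρN.exists_smul (T := (e.symm : _ →ₗ[ℂ] _) ∘ₗ P q) (by
      intro k v
      change e.symm (P q ((ρ.res N).toFun k v)) = (ρ.res N).toFun k (e.symm (P q v))
      rw [LinearEquiv.symm_apply_eq, he, hPN, hPN, ← he, LinearEquiv.apply_symm_apply])
    refine ⟨c, fun v => ?_⟩
    have h1 : e.symm (P q v) = c • v := hc v
    rw [LinearEquiv.symm_apply_eq, map_smul, he] at h1
    exact h1
  choose c hc using hc
  have hcmul : ∀ (g : G) q, c ((g : G ⧸ N) * q) = c ((g : G ⧸ N) * q₀) * c q := by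
    intro g q
    have hne : P q₀ (ρ.toFun g z) ≠ 0 := by
      rw [← he]
      simpa using hz
    apply smul_left_injective ℂ hne
    change c ((g : G ⧸ N) * q) • P q₀ (ρ.toFun g z) = (c ((g : G ⧸ N) * q₀) * c q) • _
    rw [← hc, hPg, hc, map_smul, ← hPg, hc (_ * q₀), smul_smul, mul_comm]
  apply hpy
  obtain ⟨x, rfl⟩ := QuotientGroup.mk_surjective a
  obtain ⟨y, rfl⟩ := QuotientGroup.mk_surjective b
  -- Both sides equal `c(x q₀) c(y q₀) c(1)`. Hence `p` kills the vector chosen to survive.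
  have hcc : c ((x : G ⧸ N) * y) = c ((y : G ⧸ N) * x) := by
    have h1 := hcmul x ((y : G ⧸ N) * 1)
    have h2 := hcmul y ((x : G ⧸ N) * 1)
    rw [hcmul y 1] at h1
    rw [hcmul x 1] at h2
    rw [mul_one] at h1 h2
    rw [h1, h2]
    ring
  rw [map_sub, ← hPapp, ← hPapp, hc, hc (_ * (x : G ⧸ N)), hcc, sub_self]

end CocycleRep
end ProjectiveRep

/-! ### Reduction from `G` to `M` -/

theorem mainTheorem8 {G : Type*} [Group G] [Finite G]
    (π : Set ℕ) (hπ : ∀ p ∈ π, p.Prime)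
    (M N : Subgroup G) [N.Normal] (hMN : ProjectiveRep.IsPiFactor π M N)
    (c : ProjectiveRep.SchurMultiplier G)
    (α : ProjectiveRep.Z2 G) (hα : ProjectiveRep.coclass α = c)
    {V : Type*} [AddCommGroup V] [Module ℂ V] [FiniteDimensional ℂ V]
    (φ : ProjectiveRep.CocycleRep (ProjectiveRep.resZ2 N α) V) (hφ : φ.IsIrreducible)
    (h : ∀ (X : Type) [AddCommGroup X] [Module ℂ X] [FiniteDimensional ℂ X]
      (ψ : ProjectiveRep.CocycleRep α X), ψ.IsIrreducible → ψ.LiesOver φ →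
        ProjectiveRep.primeDivisors (Module.finrank ℂ X) ⊆ ProjectiveRep.primeCompl π) :
    ∀ x y : M ⧸ N.subgroupOf M, x * y = y * x := by
  have := hMN.normal_top
  let φ' : ProjectiveRep.CocycleRep
      (ProjectiveRep.resZ2 (N.subgroupOf M) (ProjectiveRep.resZ2 M α)) V :=
    { toFun := fun x => φ.toFun ⟨x.1.1, x.2⟩
      map_mul := fun x y v => φ.map_mul ⟨x.1.1, x.2⟩ ⟨y.1.1, y.2⟩ v }
  have hφ' : φ'.IsIrreducible :=
    ⟨hφ.1, fun U hU => hφ.2 U fun n v hv => hU ⟨⟨n, hMN.le n.2⟩, n.2⟩ v hv⟩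
  refine hφ'.quotient_comm_of_coprime fun n Z hZ hZφ => ?_
  -- The hypothesis concerns modules of `G` only. It reaches `Z` because `X` lies over `φ` through
  -- `Z`, and `dim Z` divides `dim X`.
  obtain ⟨m, X, hX, hXZ⟩ := ProjectiveRep.CocycleRep.exists_irreducible_liesOver hZ
  have hdvd := hZ.finrank_dvd_of_liesOver hX hXZ
  have hXφ : X.LiesOver φ := by
    obtain ⟨f, hfi, hf⟩ := hZφ
    obtain ⟨f', hfi', hf'⟩ := hXZ
    refine ⟨f' ∘ₗ f, hfi'.comp hfi, fun n v => ?_⟩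
    have h1 := hf ⟨⟨n, hMN.le n.2⟩, n.2⟩ v
    have h2 := hf' ⟨n, hMN.le n.2⟩ (f v)
    exact (congrArg f' h1).trans h2
  refine Nat.Coprime.symm (Nat.coprime_of_dvd fun p hp hpM hpZ => ?_)
  exact (h _ X hX hXφ ⟨hp, hpZ.trans hdvd⟩).2 (hMN.primeDivisors_subset ⟨hp, hpM⟩)
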